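/- Let $N=2^n$ and let $\mathcal G$ be the hypercube graph on the $N$ bit strings of length $n$ (two strings are adjacent iff they differ in exactly one position). A distributed quantum computer with host graph $\mathcal G$ has a processor with a local memory of $Q\ge 1$ qubits at each node. Its circuits are sequences of time-steps; each time-step consists of arbitrary one- and two-qubit unitary gates on disjoint sets of qubits, such that the two qubits of every two-qubit gate lie in the same memory or in memories of neighbouring nodes, and each gate is assigned to a processor holding at least one of its qubits, with at most one gate per processor. For a placement of the $W$ qubits of ordinary circuits (gates on arbitrary disjoint single qubits and pairs of qubits) in the memories, the overhead depth factor is $$F(\mathcal G,Q,W)=\sup_C\frac{\min_{C'}\mathrm{Depth}(C')}{\mathrm{Depth}(C)},$$ where $C$ ranges over all circuits of width $W$ and $C'$ over all circuits of the distributed quantum computer that emulate $C$, i.e. that with all other (ancilla) qubits initially $|0\rangle$ map every input state of $C$ to the output state of $C$ in the same places and return all ancillas to $|0\rangle$. Suppose that $Q=O(\log N)$. Then the number of connections per node is $val(\mathcal G)=O(\log N)$ (where $val$ denotes the maximum degree), and, for every placement of the $N$ qubits of the emulated circuits that puts one of them at each node, the overhead depth factor for emulating quantum circuits of width $N$ is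 $$F(\mathcal G,Q,N)=O(\log^2 N\,\log\log N)$$ (for $N\ge 4$), with a constant that does not depend on $N$ or on the placement. -/

import Mathlib

open scoped ENNReal

namespace DQC

noncomputable section

/-- A one- or two-qubit gate on a set `ι` of qubits: an arbitrary unitary acting on one qubit or
on two distinct qubits. -/
structure Gate (ι : Type*) where
  /-- the number of qubits on which the gate acts -/
  arity : ℕ
  arity_eq : arity = 1 ∨ arity = 2
  /-- the (distinct) qubits on which the gate acts -/
  wires : Fin arity ↪ ι
  /-- the unitary performed on these qubits, in the computational basis -/
  mat : Matrix.unitaryGroup (Fin arity → Bool) ℂ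

/-- The matrix of the gate on the state space of all the qubits, i.e. the unitary of the gate
tensored with the identity on the other qubits. -/
def Gate.toMatrix {ι : Type*} [Fintype ι] [DecidableEq ι] (g : Gate ι) :
    Matrix (ι → Bool) (ι → Bool) ℂ :=
  fun x y =>
    if ∀ q : ι, (∀ i, g.wires i ≠ q) → x q = y q then
      (g.mat : Matrix (Fin g.arity → Bool) (Fin g.arity → Bool) ℂ)
        (fun i => x (g.wires i)) (fun i => y (g.wires i))
    else 0

/-- One time-step of a circuit: gates that act on pairwise disjoint sets of qubits. -/
structure Layer (ι : Type*) where
  gates : List (Gate ι)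
  disjoint : gates.Pairwise fun g h => ∀ i j, g.wires i ≠ h.wires j

/-- The matrix of a time-step (its gates act on disjoint sets of qubits, so they commute). -/
def Layer.toMatrix {ι : Type*} [Fintype ι] [DecidableEq ι] (L : Layer ι) :
    Matrix (ι → Bool) (ι → Bool) ℂ :=
  (L.gates.map Gate.toMatrix).prod

/-- A quantum circuit on the set `ι` of qubits: its time-steps, the earliest one first.
Its width is the number of elements of `ι`. -/
abbrev Circuit (ι : Type*) := List (Layer ι)

/-- The depth of a circuit is its number of time-steps. -/
def Circuit.depth {ι : Type*} (C : Circuit ι) : ℕ := List.length C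

/-- The matrix implemented by a circuit. -/
def Circuit.toMatrix {ι : Type*} [Fintype ι] [DecidableEq ι] :
    Circuit ι → Matrix (ι → Bool) (ι → Bool) ℂ
  | [] => 1
  | L :: C => Circuit.toMatrix C * L.toMatrix

/-- The constraints of the distributed model on one time-step. The processors are the nodes of
the graph `G`, and the qubit `(v, k)` is the `k`-th qubit of the memory of the processor `v`.
The qubits of a gate lie in the same memory or in neighbouring memories; each gate is assigned to
a processor that holds at least one of its qubits, at most one gate to each processor. -/
def Layer.IsDistributed {V : Type*} (G : SimpleGraph V) {Q : ℕ} (L : Layer (V × Fin Q)) : Prop :=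
  (∀ g ∈ L.gates, ∀ i j,
    (g.wires i).1 = (g.wires j).1 ∨ G.Adj (g.wires i).1 (g.wires j).1) ∧
  ∃ assign : Fin L.gates.length → V, Function.Injective assign ∧
    ∀ k, ∃ i, ((L.gates.get k).wires i).1 = assign k

/-- A circuit for the distributed quantum computer with host graph `G` and `Q` qubits at each
node. -/
def Circuit.IsDistributed {V : Type*} (G : SimpleGraph V) {Q : ℕ}
    (C : Circuit (V × Fin Q)) : Prop :=
  ∀ L ∈ C, Layer.IsDistributed G L

/-- The state of the qubits `κ` in which the qubits `loc i` are in the joint state `ψ` and all the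
other qubits (the ancillas) are in the state `|0⟩`. -/
def withAncillas {ι κ : Type*} [Fintype ι] [Fintype κ] [DecidableEq κ] (loc : ι ↪ κ)
    (ψ : (ι → Bool) → ℂ) : (κ → Bool) → ℂ :=
  fun y => if ∀ q : κ, (∀ i, loc i ≠ q) → y q = false then ψ (fun i => y (loc i)) else 0

/-- The circuit `C'` emulates the circuit `C`, where `loc i` is the qubit that stores the `i`-th
qubit of `C`: on every input state of `C`, with all ancillas initially `|0⟩`, it produces
the output state of `C` at the same places and returns all ancillas to `|0⟩`. -/
def Emulates {ι κ : Type*} [Fintype ι] [DecidableEq ι] [Fintype κ] [DecidableEq κ] (loc : ι ↪ κ)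
    (C' : Circuit κ) (C : Circuit ι) : Prop :=
  ∀ ψ : (ι → Bool) → ℂ,
    Matrix.mulVec C'.toMatrix (withAncillas loc ψ) =
      withAncillas loc (Matrix.mulVec C.toMatrix ψ)

/-- The least depth (`∞` if there is none) of a circuit for the distributed quantum computer with
host graph `G` and `Q` qubits at each node that emulates `C`. -/
def emulationDepth {V : Type*} [Fintype V] [DecidableEq V] (G : SimpleGraph V) (Q : ℕ) {W : ℕ}
    (loc : Fin W ↪ V × Fin Q) (C : Circuit (Fin W)) : ℝ≥0∞ :=
  ⨅ (C' : Circuit (V × Fin Q)) (_ : C'.IsDistributed G ∧ Emulates loc C' C), (C'.depth : ℝ≥0∞)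

/-- The overhead depth factor: the worst case over all circuits `C` of width `W` of
`Depth(C') / Depth(C)`, where `C'` is a best circuit that emulates `C` on the distributed quantum
computer. (For the circuits of depth `0` the ratio is `0 / 0 = 0`.) -/
def overheadFactor {V : Type*} [Fintype V] [DecidableEq V] (G : SimpleGraph V) (Q : ℕ) (W : ℕ)
    (loc : Fin W ↪ V × Fin Q) : ℝ≥0∞ :=
  ⨆ C : Circuit (Fin W), emulationDepth G Q loc C / (C.depth : ℝ≥0∞)

/-- The hypercube graph with `2 ^ n` nodes: two bit strings of length `n` are adjacent if and only
if they differ in exactly one position. -/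
def hypercube (n : ℕ) : SimpleGraph (Fin n → Bool) where
  Adj x y := hammingDist x y = 1
  symm := ⟨fun x y h => by rw [hammingDist_comm]; exact h⟩
  loopless := ⟨fun x h => by simp at h⟩

instance (n : ℕ) : DecidableRel (hypercube n).Adj :=
  fun x y => inferInstanceAs (Decidable (hammingDist x y = 1))

end

end DQC

/-! A single time-step has depth overhead at most `4 * n + 1`, which is linear in `log N` and so
well within the claimed bound. The two-qubit gates of a time-step act on disjoint pairs of nodes, so
some permutation of the nodes brings every pair onto an edge (`exists_perm_adj`). Permute the data
qubits accordingly, perform the gates in one step, and permute back.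

Permuting costs `2 * n` steps by the Beneš decomposition (`exists_switches`): every permutation of
the cube is a product of `2 * n` switches, each a set of disjoint swaps along edges of one
direction. Its inductive step fixes one coordinate and rests on `exists_common_twoColoring`. -/

namespace DQC

/-! ### Common 2-colourings of two involutions -/

/-- Two fixed-point-free involutions have a common proper 2-colouring. -/
theorem exists_common_twoColoring {α : Type*} [Finite α] (a b : Equiv.Perm α)
    (ha : ∀ x, a (a x) = x) (hb : ∀ x, b (b x) = x) (ha' : ∀ x, a x ≠ x) (hb' : ∀ x, b x ≠ x) :
    ∃ c : α → Bool, (∀ x, c (a x) = !c x) ∧ ∀ x, c (b x) = !c x := by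
  classical
  have ha2 : a⁻¹ = a := by
    ext x; rw [Equiv.Perm.inv_eq_iff_eq, ha]
  have hb2 : b⁻¹ = b := by
    ext x; rw [Equiv.Perm.inv_eq_iff_eq, hb]
  have hconj (k : ℤ) : a * (a * b) ^ k = (a * b) ^ (-k) * a := by
    have h : a * (a * b) * a⁻¹ = (a * b)⁻¹ := by
      rw [mul_inv_rev, hb2, ha2]
      ext x; simp [ha]
    rw [zpow_neg, ← inv_zpow, ← h, conj_zpow]
    simp
  have hconj' (k : ℤ) (x : α) : a (((a * b) ^ k) x) = ((a * b) ^ (-k)) (a x) :=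
    congrArg (fun p : Equiv.Perm α => p x) (hconj k)
  have hadd (k l : ℤ) (x : α) : ((a * b) ^ (k + l)) x = ((a * b) ^ k) (((a * b) ^ l) x) := by
    rw [zpow_add]; rfl
  -- If `(a * b) ^ k` sends `x` to `a x`, then the point `(a * b) ^ m x` halfway along is fixed by
  -- `a` (for `k = 2 * m`) or by `b` (for `k = 2 * m + 1`).
  have hne (x : α) : ¬ (a * b).SameCycle x (a x) := by
    rintro ⟨k, hk⟩
    obtain ⟨m, rfl | rfl⟩ := Int.even_or_odd' k
    · apply ha' (((a * b) ^ m) x)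
      rw [hconj', ← hk, ← hadd]
      congr 2; ring
    · apply hb' (((a * b) ^ m) x)
      have h : a (b (((a * b) ^ m) x)) = a (((a * b) ^ m) x) := by
        rw [hconj', ← hk, ← hadd]
        have : -m + (2 * m + 1) = 1 + m := by ring
        rw [this, hadd, zpow_one]; rfl
      exact a.injective h
  have hresp (x y : α) (h : (a * b).SameCycle x y) : (a * b).SameCycle (a x) (a y) := by
    obtain ⟨k, rfl⟩ := h
    exact ⟨-k, (hconj' k x).symm⟩
  obtain ⟨f⟩ : Nonempty (α ↪ ℕ) := ⟨(Finite.equivFin α).toEmbedding.trans Fin.valEmbedding⟩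
  let S := Equiv.Perm.SameCycle.setoid (a * b)
  -- `r` labels the cycles of `a * b`. By `hne` and `hresp`, `a` matches distinct cycles in pairs;
  -- the colour tells which cycle of a pair has the smaller label.
  let r : α → ℕ := fun x => f (Quotient.mk S x).out
  have hr (x y : α) : r x = r y ↔ (a * b).SameCycle x y := by
    constructor
    · intro h
      have := congrArg (Quotient.mk S) (f.injective h)
      rw [Quotient.out_eq, Quotient.out_eq] at this
      exact Quotient.exact this
    · intro h
      have : Quotient.mk S x = Quotient.mk S y := Quotient.sound h
      simp only [r, this]
  have hca (x : α) : decide (r (a x) < r (a (a x))) = !decide (r x < r (a x)) := by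
    have h : r x ≠ r (a x) := fun h => hne x ((hr _ _).1 h)
    rw [ha]
    by_cases h1 : r x < r (a x)
    · simp [h1, h1.le]
    · simp only [h1, decide_false, Bool.not_false, decide_eq_true_eq]; omega
  refine ⟨fun x => decide (r x < r (a x)), hca, fun x => ?_⟩
  -- `b x` lies in the cycle of `a x`, so it gets the colour of `a x`.
  have h1 : (a * b).SameCycle x (a (b x)) := ⟨1, by simp⟩
  have h2 := hresp _ _ h1
  rw [ha] at h2
  rw [← hca x, (hr _ _).2 h2, ha, (hr _ _).2 h1]

/-! ### Switches and the Beneš decomposition -/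

/-- Flipping the bit in direction `d`. -/
def flipBit {n : ℕ} (d : Fin n) (v : Fin n → Bool) : Fin n → Bool :=
  Function.update v d (!v d)

@[simp] theorem flipBit_self {n : ℕ} (d : Fin n) (v : Fin n → Bool) : flipBit d v d = !v d := by
  simp [flipBit]

theorem flipBit_of_ne {n : ℕ} {d i : Fin n} (h : i ≠ d) (v : Fin n → Bool) : flipBit d v i = v i := by
  simp [flipBit, h]

@[simp] theorem flipBit_flipBit {n : ℕ} (d : Fin n) (v : Fin n → Bool) : flipBit d (flipBit d v) = v := by
  simp [flipBit]

theorem flipBit_ne {n : ℕ} (d : Fin n) (v : Fin n → Bool) : flipBit d v ≠ v := fun h => by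
  have := congrFun h d
  simp at this

theorem hypercube_adj_flipBit {n : ℕ} (d : Fin n) (v : Fin n → Bool) :
    (hypercube n).Adj v (flipBit d v) := by
  change hammingDist v (flipBit d v) = 1
  rw [hammingDist, Finset.card_eq_one]
  refine ⟨d, ?_⟩
  ext i
  by_cases h : i = d
  · subst h; simp
  · simp [flipBit_of_ne h, h]

theorem eq_or_eq_flipBit {n : ℕ} {d : Fin n} {v w : Fin n → Bool} (h : ∀ i, i ≠ d → w i = v i) :
    w = v ∨ w = flipBit d v := by
  by_cases hd : w d = v d
  · left; ext i
    by_cases hi : i = d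
    · rw [hi, hd]
    · rw [h i hi]
  · right; ext i
    by_cases hi : i = d
    · subst hi; simp [Bool.eq_not.2 hd]
    · rw [h i hi, flipBit_of_ne hi]

/-- A permutation of the nodes of the hypercube that exchanges the endpoints of some edges in a
single direction. -/
def IsSwitch {n : ℕ} (τ : Equiv.Perm (Fin n → Bool)) : Prop :=
  ∃ d, ∀ v, τ v = v ∨ τ v = flipBit d v

theorem IsSwitch.symm {n : ℕ} {τ : Equiv.Perm (Fin n → Bool)} (h : IsSwitch τ) :
    IsSwitch τ⁻¹ := by
  obtain ⟨d, h⟩ := h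
  refine ⟨d, fun v => ?_⟩
  obtain ⟨w, rfl⟩ := τ.surjective v
  rw [show τ⁻¹ (τ w) = w from τ.symm_apply_apply w]
  rcases h w with h | h <;> rw [h] <;> simp

/-- The switch setting the bit in direction `d` according to a colouring of the nodes. -/
theorem exists_switch_of_coloring {n : ℕ} (d : Fin n) (c : (Fin n → Bool) → Bool)
    (hc : ∀ v, c (flipBit d v) = !c v) :
    ∃ τ : Equiv.Perm (Fin n → Bool), IsSwitch τ ∧ ∀ v, τ v = Function.update v d (c v) := by
  have hinj : Function.Injective fun v : Fin n → Bool => Function.update v d (c v) := by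
    intro v w h
    have hoff : ∀ i, i ≠ d → w i = v i := fun i hi => by
      have := congrFun h i
      simpa [hi] using this.symm
    have hd : c v = c w := by simpa using congrFun h d
    rcases eq_or_eq_flipBit hoff with h1 | h1
    · exact h1.symm
    · rw [h1, hc] at hd
      simp at hd
  refine ⟨Equiv.ofBijective _ (Finite.injective_iff_bijective.1 hinj), ⟨d, fun v => ?_⟩,
    fun v => rfl⟩
  exact eq_or_eq_flipBit fun i hi => by simp [hi]

/-- Induction on the number of coordinates still to be routed. One switch before and one after the
recursive part handle coordinate `k`, hence two switches per coordinate. -/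
theorem exists_switches_of_fixes {n : ℕ} (k : ℕ) (hk : k ≤ n) (σ : Equiv.Perm (Fin n → Bool))
    (hσ : ∀ v (i : Fin n), k ≤ i → σ v i = v i) :
    ∃ l : List (Equiv.Perm (Fin n → Bool)), l.length = 2 * k ∧ (∀ τ ∈ l, IsSwitch τ) ∧
      l.prod = σ := by
  induction k generalizing σ with
  | zero =>
    refine ⟨[], rfl, by simp, ?_⟩
    ext v i
    simp [hσ v i (Nat.zero_le _)]
  | succ k ih =>
    let d : Fin n := ⟨k, hk⟩
    let a : Equiv.Perm (Fin n → Bool) :=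
      ⟨flipBit d, flipBit d, flipBit_flipBit d, flipBit_flipBit d⟩
    -- `c v` is the value of bit `d` with which the item starting at `v` crosses the middle. Items
    -- that start on a common `d`-edge, or end on one, must get different values; these are the two
    -- involutions. Then `τ` and `ρ` write the same bit `c v` at the source `v` and at the target `σ
    -- v`, so `ρ * σ * τ⁻¹` preserves bit `d`.
    obtain ⟨c, hca, hcb⟩ := exists_common_twoColoring a (σ⁻¹ * a * σ) (flipBit_flipBit d)
      (fun v => by simp [a]) (flipBit_ne d)
      (fun v h => flipBit_ne d (σ v) (Equiv.Perm.inv_eq_iff_eq.1 h))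
    obtain ⟨τ, hτ, hτ'⟩ := exists_switch_of_coloring d c hca
    obtain ⟨ρ, hρ, hρ'⟩ := exists_switch_of_coloring d (fun v => c (σ⁻¹ v)) (fun v => by
      have := hcb (σ⁻¹ v)
      simpa [a] using this)
    obtain ⟨l, hl, hl', hl''⟩ := ih (by omega) (ρ * σ * τ⁻¹) (fun w i hi => by
      obtain ⟨v, rfl⟩ := τ.surjective w
      have hinv (p : Equiv.Perm (Fin n → Bool)) (v) : p⁻¹ (p v) = v := p.symm_apply_apply v
      rw [Equiv.Perm.mul_apply, Equiv.Perm.mul_apply, hinv, hρ', hinv, hτ']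
      by_cases hid : i = d
      · subst hid; simp
      · simp only [ne_eq, hid, not_false_eq_true, Function.update_of_ne]
        refine hσ v i ?_
        have : (i : ℕ) ≠ k := fun h => hid (Fin.ext h)
        omega)
    refine ⟨ρ⁻¹ :: (l ++ [τ]), by simp [hl]; ring, ?_, ?_⟩
    · intro p hp
      simp only [List.mem_cons, List.mem_append, List.not_mem_nil, or_false] at hp
      rcases hp with rfl | hp | rfl
      · exact hρ.symm
      · exact hl' p hp
      · exact hτ
    · simp [hl'', mul_assoc]

/-- The Beneš network: every permutation of the nodes of the hypercube is a product of `2 * n`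
switches. -/
theorem exists_switches {n : ℕ} (σ : Equiv.Perm (Fin n → Bool)) :
    ∃ l : List (Equiv.Perm (Fin n → Bool)), l.length = 2 * n ∧ (∀ τ ∈ l, IsSwitch τ) ∧
      l.prod = σ :=
  exists_switches_of_fixes n le_rfl σ fun _ i hi => absurd i.2 (not_lt.2 hi)

/-! ### Moving pairs onto edges; the degree bound -/

/-- Disjoint pairs of nodes can be moved simultaneously to pairs of neighbours. -/
theorem exists_perm_adj {n : ℕ} (hn : n ≠ 0) {γ : Type*} (w : γ × Bool → Fin n → Bool)
    (hw : Function.Injective w) :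
    ∃ π : Equiv.Perm (Fin n → Bool),
      ∀ g, (hypercube n).Adj (π (w (g, false))) (π (w (g, true))) := by
  classical
  obtain ⟨m, rfl⟩ := Nat.exists_eq_succ_of_ne_zero hn
  have : Finite (γ × Bool) := Finite.of_injective w hw
  have : Finite γ := Finite.of_injective (fun g : γ => (g, false)) fun g h => by simp
  have := Fintype.ofFinite γ
  have hcard : Fintype.card γ ≤ Fintype.card (Fin m → Bool) := by
    have := Fintype.card_le_of_injective w hw
    simp [pow_succ] at this
    simpa using this
  obtain ⟨h⟩ := Function.Embedding.nonempty_of_card_le hcard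
  -- Each pair receives its own edge in direction `0`; there are `2 ^ m` of these, enough by
  -- counting endpoints.
  let r : γ × Bool → Fin (m + 1) → Bool := fun p => Fin.cons p.2 (h p.1)
  have hr : Function.Injective r := by
    rintro ⟨g, b⟩ ⟨g', b'⟩ hgg
    have := Fin.cons_injective2 hgg
    exact Prod.ext (h.injective this.2) this.1
  let E : {x // x ∈ Set.range w} ≃ {x // x ∈ Set.range r} :=
    (Equiv.ofInjective w hw).symm.trans (Equiv.ofInjective r hr)
  have hE (p) : E.extendSubtype (w p) = r p := by
    rw [Equiv.extendSubtype_apply_of_mem _ _ ⟨p, rfl⟩]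
    have : (⟨w p, p, rfl⟩ : {x // x ∈ Set.range w}) = Equiv.ofInjective w hw p := rfl
    simp only [E, Equiv.trans_apply, this, Equiv.symm_apply_apply]
    rfl
  refine ⟨E.extendSubtype, fun g => ?_⟩
  have hflip : r (g, true) = flipBit 0 (r (g, false)) := by
    simp [flipBit, r]
  rw [hE, hE, hflip]
  exact hypercube_adj_flipBit 0 _

theorem hypercube_maxDegree_le (n : ℕ) : (hypercube n).maxDegree ≤ n := by
  refine SimpleGraph.maxDegree_le_of_forall_degree_le _ _ fun v => ?_
  rw [← SimpleGraph.card_neighborFinset_eq_degree]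
  calc ((hypercube n).neighborFinset v).card
      ≤ (Finset.univ.image fun d : Fin n => flipBit d v).card := by
        refine Finset.card_le_card fun w hw => ?_
        have h : hammingDist v w = 1 := (SimpleGraph.mem_neighborFinset _ _ _).1 hw
        rw [hammingDist, Finset.card_eq_one] at h
        obtain ⟨d, hd⟩ := h
        have hi (i : Fin n) : v i ≠ w i ↔ i = d := by
          simpa using (Finset.ext_iff.1 hd) i
        have := eq_or_eq_flipBit (d := d) (v := v) (w := w) fun i hid =>
          (not_not.1 fun h => hid ((hi i).1 (Ne.symm h)))
        refine Finset.mem_image.2 ⟨d, Finset.mem_univ _, ?_⟩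
        rcases this with h | h
        · exact absurd (congrFun h d).symm ((hi d).2 rfl)
        · exact h.symm
    _ ≤ n := Finset.card_image_le.trans (by simp)

/-! ### Swap gates, relocated circuits and concatenation -/

section Circuits

variable {ι κ : Type*}

theorem permMatrix_swap_apply (u v : Fin 2 → Bool) :
    Equiv.Perm.permMatrix ℂ ((Equiv.swap (0 : Fin 2) 1).arrowCongr (Equiv.refl Bool)) u v =
      if u 0 = v 1 ∧ u 1 = v 0 then 1 else 0 := by
  rw [Equiv.Perm.permMatrix, PEquiv.toMatrix_apply]
  congr 1
  simp only [Equiv.toPEquiv_apply, Option.mem_def, Option.some.injEq, eq_iff_iff]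
  rw [funext_iff, Fin.forall_fin_two, and_comm]
  rfl

/-- The gate that exchanges two qubits. -/
noncomputable def swapGate (a b : κ) (h : a ≠ b) : Gate κ where
  arity := 2
  arity_eq := Or.inr rfl
  wires := ⟨![a, b], by intro i j; fin_cases i <;> fin_cases j <;> simp [h, h.symm]⟩
  mat := ⟨Equiv.Perm.permMatrix ℂ ((Equiv.swap (0 : Fin 2) 1).arrowCongr (Equiv.refl Bool)), by
    rw [Matrix.mem_unitaryGroup_iff, Matrix.star_eq_conjTranspose, Matrix.conjTranspose_permMatrix,
      ← Matrix.permMatrix_mul, inv_mul_cancel, Matrix.permMatrix_one]⟩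

variable [Fintype ι] [Fintype κ] [DecidableEq κ]

theorem swapGate_toMatrix_apply (a b : κ) (h : a ≠ b) (x y : κ → Bool) :
    (swapGate a b h).toMatrix x y = if x ∘ Equiv.swap a b = y then 1 else 0 := by
  have key : (x ∘ Equiv.swap a b = y) ↔
      (∀ q, (∀ i, (swapGate a b h).wires i ≠ q) → x q = y q) ∧ x a = y b ∧ x b = y a := by
    constructor
    · rintro rfl
      refine ⟨fun q hq => ?_, by simp, by simp⟩
      have h0 : a ≠ q := hq (0 : Fin 2)
      have h1 : b ≠ q := hq (1 : Fin 2)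
      simp [Equiv.swap_apply_of_ne_of_ne h0.symm h1.symm]
    · rintro ⟨h1, h2, h3⟩
      ext q
      by_cases ha : q = a
      · subst ha; simp [h3]
      by_cases hb : q = b
      · subst hb; simp [h2]
      rw [Function.comp_apply, Equiv.swap_apply_of_ne_of_ne ha hb]
      refine h1 q fun (i : Fin 2) => ?_
      fin_cases i
      · exact Ne.symm ha
      · exact Ne.symm hb
  have hmat : (swapGate a b h).mat.1
      (fun i => x ((swapGate a b h).wires i)) (fun i => y ((swapGate a b h).wires i)) =
      if x a = y b ∧ x b = y a then 1 else 0 := permMatrix_swap_apply _ _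
  simp only [Gate.toMatrix, key, hmat]
  split_ifs <;> tauto

theorem swapGate_mulVec (a b : κ) (h : a ≠ b) (φ : (κ → Bool) → ℂ) :
    (swapGate a b h).toMatrix.mulVec φ = fun x => φ (x ∘ Equiv.swap a b) := by
  ext x
  simp [Matrix.mulVec, dotProduct, swapGate_toMatrix_apply]

/-- Together with `swapGate_mulVec`, this reduces the action of swap gates to bookkeeping of data
locations. -/
theorem withAncillas_comp_perm (loc : ι ↪ κ) (σ : Equiv.Perm κ) (ψ : (ι → Bool) → ℂ)
    (x : κ → Bool) :
    withAncillas loc ψ (x ∘ σ) = withAncillas (loc.trans σ.toEmbedding) ψ x := by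
  have h : (∀ q, (∀ i, loc i ≠ q) → (x ∘ σ) q = false) ↔
      ∀ q, (∀ i, loc.trans σ.toEmbedding i ≠ q) → x q = false := by
    rw [σ.forall_congr_left]
    simp [Equiv.eq_symm_apply]
  unfold withAncillas
  simp only [h]
  rfl

variable [DecidableEq ι]

/-- A gate of a circuit performed on the qubits that store the qubits of the circuit. -/
def Gate.map (loc : ι ↪ κ) (g : Gate ι) : Gate κ where
  arity := g.arity
  arity_eq := g.arity_eq
  wires := g.wires.trans loc
  mat := g.mat

/-- The relocated gate touches no ancilla. At a string `x` with all ancillas `false`, only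
extensions by `false` of data strings contribute to the sum; at any other `x`, both sides vanish. -/
theorem Gate.map_mulVec_withAncillas (loc : ι ↪ κ) (g : Gate ι) (ψ : (ι → Bool) → ℂ) :
    (g.map loc).toMatrix.mulVec (withAncillas loc ψ) =
      withAncillas loc (g.toMatrix.mulVec ψ) := by
  ext x
  by_cases hx : ∀ q : κ, (∀ i, loc i ≠ q) → x q = false
  · rw [withAncillas, if_pos hx]
    simp only [Matrix.mulVec, dotProduct]
    let e : (ι → Bool) → κ → Bool := fun z => Function.extend loc z fun _ => false
    have he (z i) : e z (loc i) = z i := loc.injective.extend_apply _ _ _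
    have he' (z q) (hq : ∀ i, loc i ≠ q) : e z q = false :=
      Function.extend_apply' _ _ _ fun ⟨i, hi⟩ => hq i hi
    symm
    refine Fintype.sum_of_injective e (fun z w h => ?_) _ _ (fun y hy => ?_) fun z => ?_
    · ext i
      rw [← he z, h, he]
    · rw [withAncillas, if_neg, mul_zero]
      intro h
      refine hy ⟨fun i => y (loc i), ?_⟩
      ext q
      by_cases hq : ∃ i, loc i = q
      · obtain ⟨i, rfl⟩ := hq
        exact he _ i
      · rw [he' _ q fun i hi => hq ⟨i, hi⟩, h q fun i hi => hq ⟨i, hi⟩]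
    · rw [withAncillas, if_pos fun q hq => he' z q hq]
      simp only [he]
      congr 1
      have h : (∀ q, (∀ i, (g.map loc).wires i ≠ q) → x q = e z q) ↔
          ∀ q, (∀ i, g.wires i ≠ q) → x (loc q) = z q := by
        constructor
        · intro h q hq
          rw [← he z]
          exact h _ fun i hi => hq i (loc.injective hi)
        · intro h q hq
          by_cases hq' : ∃ i, loc i = q
          · obtain ⟨i, rfl⟩ := hq'
            rw [he]
            exact h i fun j hj => hq j (congrArg loc hj)
          · rw [he' _ q fun i hi => hq' ⟨i, hi⟩, hx q fun i hi => hq' ⟨i, hi⟩]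
      unfold Gate.toMatrix
      simp only [h]
      have h' : (fun i => e z ((g.map loc).wires i)) = fun i => z (g.wires i) :=
        funext fun i => he z _
      rw [h']
      rfl
  · rw [withAncillas, if_neg hx]
    simp only [Matrix.mulVec, dotProduct]
    refine Finset.sum_eq_zero fun y _ => ?_
    push Not at hx
    obtain ⟨q, hq, hxq⟩ := hx
    by_cases hxy : ∀ q, (∀ i, (g.map loc).wires i ≠ q) → x q = y q
    · rw [withAncillas, if_neg, mul_zero]
      intro h
      exact hxq ((hxy q fun i => hq _).trans (h q hq))
    · rw [Gate.toMatrix, if_neg hxy, zero_mul]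

/-- A time-step of a circuit performed on the qubits that store the qubits of the circuit. -/
def Layer.map (loc : ι ↪ κ) (L : Layer ι) : Layer κ where
  gates := L.gates.map (Gate.map loc)
  disjoint := by
    rw [List.pairwise_map]
    exact L.disjoint.imp fun h i j hij => h i j (loc.injective hij)

theorem Layer.map_mulVec_withAncillas (loc : ι ↪ κ) (L : Layer ι) (ψ : (ι → Bool) → ℂ) :
    (L.map loc).toMatrix.mulVec (withAncillas loc ψ) =
      withAncillas loc (L.toMatrix.mulVec ψ) := by
  have h (l : List (Gate ι)) :
      ((l.map (Gate.map loc)).map Gate.toMatrix).prod.mulVec (withAncillas loc ψ) =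
        withAncillas loc ((l.map Gate.toMatrix).prod.mulVec ψ) := by
    induction l with
    | nil => simp
    | cons g l ih =>
      simp only [List.map_cons, List.prod_cons, ← Matrix.mulVec_mulVec]
      rw [ih, Gate.map_mulVec_withAncillas]
  exact h L.gates

theorem Circuit.toMatrix_append (C D : Circuit κ) :
    Circuit.toMatrix (C ++ D) = D.toMatrix * C.toMatrix := by
  induction C with
  | nil => simp [Circuit.toMatrix]
  | cons L C ih => simp [Circuit.toMatrix, ih, mul_assoc]

theorem Circuit.toMatrix_singleton (L : Layer κ) : Circuit.toMatrix [L] = L.toMatrix := by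
  simp [Circuit.toMatrix]

theorem Emulates.append {loc : ι ↪ κ} {C' D' : Circuit κ} {C D : Circuit ι}
    (hC : Emulates loc C' C) (hD : Emulates loc D' D) : Emulates loc (C' ++ D') (C ++ D) := by
  intro ψ
  rw [Circuit.toMatrix_append, Circuit.toMatrix_append, ← Matrix.mulVec_mulVec, hC, hD,
    ← Matrix.mulVec_mulVec]

theorem exists_emulates_of_forall_layer {V : Type*} [Fintype V] [DecidableEq V]
    (G : SimpleGraph V) {Q : ℕ} (loc : ι ↪ V × Fin Q) (D : ℕ)
    (h : ∀ L : Layer ι, ∃ C' : Circuit (V × Fin Q), C'.IsDistributed G ∧ C'.depth = D ∧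
      Emulates loc C' [L]) (C : Circuit ι) :
    ∃ C' : Circuit (V × Fin Q), C'.IsDistributed G ∧ C'.depth = D * C.depth ∧
      Emulates loc C' C := by
  induction C with
  | nil => exact ⟨[], by simp [Circuit.IsDistributed], rfl, fun ψ => by simp [Circuit.toMatrix]⟩
  | cons L C ih =>
    obtain ⟨A, hA, hA', hA''⟩ := h L
    obtain ⟨B, hB, hB', hB''⟩ := ih
    refine ⟨A ++ B, fun M hM => ?_, ?_, hA''.append hB''⟩
    · rcases List.mem_append.1 hM with hM | hM
      exacts [hA M hM, hB M hM]
    · simp only [Circuit.depth, List.length_append, List.length_cons] at *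
      rw [hA', hB']; ring

theorem overheadFactor_le {V : Type*} [Fintype V] [DecidableEq V] (G : SimpleGraph V) {Q W : ℕ}
    (loc : Fin W ↪ V × Fin Q) (D : ℕ)
    (h : ∀ L : Layer (Fin W), ∃ C' : Circuit (V × Fin Q), C'.IsDistributed G ∧ C'.depth = D ∧
      Emulates loc C' [L]) :
    overheadFactor G Q W loc ≤ D := by
  -- Depth `0` needs no separate case: the product bound then makes the numerator `0`.
  refine iSup_le fun C => ENNReal.div_le_of_le_mul ?_
  obtain ⟨C', h1, h2, h3⟩ := exists_emulates_of_forall_layer G loc D h C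
  refine (iInf₂_le C' ⟨h1, h3⟩).trans ?_
  rw [h2]
  push_cast
  rfl

end Circuits

/-! ### Routing on the hypercube -/

section Routing

variable {n Q : ℕ}

/-- The data qubit of each node of the hypercube, `s v` being its position in the memory. -/
def dataQubit (s : (Fin n → Bool) → Fin Q) : (Fin n → Bool) ↪ (Fin n → Bool) × Fin Q :=
  ⟨fun v => (v, s v), fun _ _ h => congrArg Prod.fst h⟩

theorem dataQubit_fst (s : (Fin n → Bool) → Fin Q) (v) : (dataQubit s v).1 = v := rfl

/-- A time-step whose gates act on data qubits of pairwise equal or adjacent nodes satisfies the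
constraints of the distributed model. -/
theorem Layer.isDistributed_of_dataQubit (G : SimpleGraph (Fin n → Bool))
    (s : (Fin n → Bool) → Fin Q) (L : Layer ((Fin n → Bool) × Fin Q))
    (hs : ∀ g ∈ L.gates, ∀ i, g.wires i ∈ Set.range (dataQubit s))
    (hG : ∀ g ∈ L.gates, ∀ i j, (g.wires i).1 = (g.wires j).1 ∨
      G.Adj (g.wires i).1 (g.wires j).1) : L.IsDistributed G := by
  have hpos (g : Gate ((Fin n → Bool) × Fin Q)) : 0 < g.arity := by
    rcases g.arity_eq with h | h <;> omega
  -- Assign each gate to the node of its first wire. A node has only one data qubit, so disjoint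
  -- gates get different nodes.
  refine ⟨hG, fun k => ((L.gates.get k).wires ⟨0, hpos _⟩).1, ?_, fun k => ⟨_, rfl⟩⟩
  intro k l hkl
  obtain ⟨v, hv⟩ := hs _ (L.gates.get_mem k) ⟨0, hpos _⟩
  obtain ⟨w, hw⟩ := hs _ (L.gates.get_mem l) ⟨0, hpos _⟩
  have hvw : v = w := by
    simp only [← hv, ← hw, dataQubit_fst] at hkl
    exact hkl
  subst hvw
  have hdis := List.pairwise_iff_get.1 L.disjoint
  rcases lt_trichotomy k l with h | h | h
  · exact absurd (hv.symm.trans hw) (hdis k l h _ _)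
  · exact h
  · exact absurd (hw.symm.trans hv) (hdis l k h _ _)

/-- Naming each `d`-edge by its endpoint with bit `d` equal to `false` makes the swaps disjoint, so
at most one of them moves `x`. -/
theorem prod_swap_flipBit_apply (d : Fin n) (l : List (Fin n → Bool)) (hl : l.Nodup)
    (hd : ∀ v ∈ l, v d = false) (x : Fin n → Bool) :
    (l.map fun v => Equiv.swap v (flipBit d v)).prod x =
      if x ∈ l ∨ flipBit d x ∈ l then flipBit d x else x := by
  induction l with
  | nil => simp
  | cons v l ih =>
    have hv : v ∉ l := (List.nodup_cons.1 hl).1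
    have hvd : v d = false := hd v (by simp)
    have hd' : ∀ w ∈ l, w d = false := fun w hw => hd w (by simp [hw])
    have hfv : flipBit d v ∉ l := fun h => by simpa [hvd] using hd' _ h
    rw [List.map_cons, List.prod_cons, Equiv.Perm.mul_apply, ih (List.nodup_cons.1 hl).2 hd']
    by_cases h1 : x = v
    · subst h1; simp [hv, hfv]
    by_cases h2 : x = flipBit d v
    · subst h2; simp [hv, hfv]
    have h3 : flipBit d x ≠ v := fun h => h2 (by rw [← h, flipBit_flipBit])
    have h4 : flipBit d x ≠ flipBit d v := fun h =>
      h1 (by rw [← flipBit_flipBit d x, h, flipBit_flipBit])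
    simp only [List.mem_cons, h1, h3, false_or]
    split_ifs
    · exact Equiv.swap_apply_of_ne_of_ne h3 h4
    · exact Equiv.swap_apply_of_ne_of_ne h1 h2

/-- The circuit moves the data qubits according to the permutation `σ` of the nodes. -/
def Routes (s : (Fin n → Bool) → Fin Q) (C : Circuit ((Fin n → Bool) × Fin Q))
    (σ : Equiv.Perm (Fin n → Bool)) : Prop :=
  ∀ {ι : Type} [Fintype ι] (f : ι ↪ Fin n → Bool) (ψ : (ι → Bool) → ℂ),
    C.toMatrix.mulVec (withAncillas (f.trans (dataQubit s)) ψ) =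
      withAncillas ((f.trans σ.toEmbedding).trans (dataQubit s)) ψ

/-- A switch is performed by one time-step of swap gates. -/
theorem IsSwitch.exists_routes {τ : Equiv.Perm (Fin n → Bool)} (hτ : IsSwitch τ)
    (s : (Fin n → Bool) → Fin Q) :
    ∃ L : Layer ((Fin n → Bool) × Fin Q), L.IsDistributed (hypercube n) ∧ Routes s [L] τ := by
  classical
  obtain ⟨d, hd⟩ := hτ
  let j := dataQubit s
  have hne (v) : j v ≠ j (flipBit d v) := fun h => flipBit_ne d v (j.injective h).symm
  let l : List (Fin n → Bool) :=
    (Finset.univ.filter fun v => v d = false ∧ τ v = flipBit d v).toList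
  have hmem (v) : v ∈ l ↔ v d = false ∧ τ v = flipBit d v := by simp [l]
  have hl : l.Nodup := Finset.nodup_toList _
  let L : Layer ((Fin n → Bool) × Fin Q) :=
    { gates := l.map fun v => swapGate (j v) (j (flipBit d v)) (hne v)
      disjoint := by
        rw [List.pairwise_map]
        refine hl.imp_of_mem fun {v w} hv hw hvw => ?_
        have h1 : flipBit d v ≠ flipBit d w := fun h =>
          hvw (by rw [← flipBit_flipBit d v, h, flipBit_flipBit])
        have hvd := ((hmem v).1 hv).1
        have hwd := ((hmem w).1 hw).1
        have h2 : v ≠ flipBit d w := fun h => by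
          have := congrFun h d
          simp [hvd, hwd] at this
        have h3 : flipBit d v ≠ w := fun h => by
          have := congrFun h d
          simp [hvd, hwd] at this
        change ∀ a b : Fin 2, _
        intro a b
        fin_cases a <;> fin_cases b
        exacts [j.injective.ne hvw, j.injective.ne h2, j.injective.ne h3, j.injective.ne h1] }
  refine ⟨L, Layer.isDistributed_of_dataQubit _ s L ?_ ?_, ?_⟩
  · intro g hg
    obtain ⟨v, hv, rfl⟩ := List.mem_map.1 hg
    change ∀ i : Fin 2, _
    intro i
    fin_cases i
    exacts [⟨v, rfl⟩, ⟨flipBit d v, rfl⟩]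
  · intro g hg
    obtain ⟨v, hv, rfl⟩ := List.mem_map.1 hg
    change ∀ a b : Fin 2, _
    intro a b
    fin_cases a <;> fin_cases b
    exacts [Or.inl rfl, Or.inr (hypercube_adj_flipBit d v),
      Or.inr (hypercube_adj_flipBit d v).symm, Or.inl rfl]
  · intro ι _ f ψ
    have hcirc (l : List (Fin n → Bool)) :
        ((l.map fun v => swapGate (j v) (j (flipBit d v)) (hne v)).map Gate.toMatrix).prod.mulVec
            (withAncillas (f.trans j) ψ) =
          withAncillas ((f.trans (l.map fun v =>
            Equiv.swap v (flipBit d v)).prod.toEmbedding).trans j) ψ := by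
      induction l with
      | nil => simp; rfl
      | cons v l ih =>
        simp only [List.map_cons, List.prod_cons, ← Matrix.mulVec_mulVec]
        rw [ih, swapGate_mulVec]
        ext x
        rw [withAncillas_comp_perm]
        congr 1
        ext1 i
        exact j.injective.swap_apply _ _ _
    rw [Circuit.toMatrix_singleton]
    refine (hcirc l).trans ?_
    congr 2
    ext1 i
    change (l.map fun v => Equiv.swap v (flipBit d v)).prod (f i) = τ (f i)
    rw [prod_swap_flipBit_apply d l hl fun v hv => ((hmem v).1 hv).1]
    generalize f i = v
    -- By injectivity, `τ` moves both endpoints of a `d`-edge or neither, so testing the endpoint in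
    -- `l` suffices.
    have hiff : τ (flipBit d v) = v ↔ τ v = flipBit d v := by
      constructor
      · intro h
        refine (hd v).resolve_left fun h' => flipBit_ne d v (τ.injective (h.trans h'.symm))
      · intro h
        rw [(hd (flipBit d v)).resolve_left fun h' =>
          flipBit_ne d v (τ.injective (h'.trans h.symm)), flipBit_flipBit]
    simp only [hmem, flipBit_self, flipBit_flipBit, hiff]
    cases v d <;> simp <;> rcases hd v with h | h <;> simp [h, (flipBit_ne d v).symm]

/-- Every permutation of the nodes is performed by `2 * n` time-steps. -/
theorem exists_routes (s : (Fin n → Bool) → Fin Q) (σ : Equiv.Perm (Fin n → Bool)) :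
    ∃ C : Circuit ((Fin n → Bool) × Fin Q), C.IsDistributed (hypercube n) ∧
      C.depth = 2 * n ∧ Routes s C σ := by
  obtain ⟨l, hl, hsw, rfl⟩ := exists_switches σ
  rw [← hl]
  clear hl
  induction l with
  | nil =>
    refine ⟨[], by simp [Circuit.IsDistributed], rfl, fun f ψ => ?_⟩
    simp [Circuit.toMatrix]; rfl
  | cons τ l ih =>
    obtain ⟨C, hC, hC', hC''⟩ := ih fun p hp => hsw p (by simp [hp])
    obtain ⟨L, hL, hL'⟩ := (hsw τ (by simp)).exists_routes s
    refine ⟨C ++ [L], fun M hM => ?_, ?_, fun f ψ => ?_⟩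
    · rcases List.mem_append.1 hM with hM | hM
      · exact hC M hM
      · rw [List.mem_singleton.1 hM]; exact hL
    · simp only [Circuit.depth, List.length_append, List.length_cons, List.length_nil] at *
      omega
    -- `Routes` holds for every placement, so `hL'` applies to the one that `C` leaves behind.
    · rw [Circuit.toMatrix_append, ← Matrix.mulVec_mulVec, hC'', hL']
      rfl

/-- One time-step on the data qubits, one at each node, is emulated by `4 * n + 1` time-steps. -/
theorem exists_emulates_layer (hn : n ≠ 0) {ι : Type} [Fintype ι] [DecidableEq ι]
    (f : ι ↪ Fin n → Bool) (s : (Fin n → Bool) → Fin Q) (L : Layer ι) :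
    ∃ C' : Circuit ((Fin n → Bool) × Fin Q), C'.IsDistributed (hypercube n) ∧
      C'.depth = 4 * n + 1 ∧ Emulates (f.trans (dataQubit s)) C' [L] := by
  -- Only two-qubit gates constrain the routing; one-qubit gates can be performed wherever their
  -- qubit lands.
  let γ := {k : Fin L.gates.length // (L.gates.get k).arity = 2}
  let u : γ × Bool → ι := fun p =>
    (L.gates.get p.1.1).wires (Fin.cast p.1.2.symm (if p.2 then 1 else 0))
  have hdis := List.pairwise_iff_get.1 L.disjoint
  have hu : Function.Injective u := by
    rintro ⟨⟨k, hk⟩, a⟩ ⟨⟨l, hl⟩, b⟩ h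
    rcases lt_trichotomy k l with hkl | hkl | hkl
    · exact absurd h (hdis k l hkl _ _)
    · subst hkl
      have := (L.gates.get k).wires.injective h
      cases a <;> cases b <;> simp_all
    · exact absurd h.symm (hdis l k hkl _ _)
  obtain ⟨π, hπ⟩ := exists_perm_adj hn (f ∘ u) (f.injective.comp hu)
  obtain ⟨A, hA, hA', hA''⟩ := exists_routes s π
  obtain ⟨B, hB, hB', hB''⟩ := exists_routes s π⁻¹
  let M := L.map ((f.trans π.toEmbedding).trans (dataQubit s))
  have hM : M.IsDistributed (hypercube n) := by
    refine Layer.isDistributed_of_dataQubit _ s M (fun g hg i => ?_) fun g hg => ?_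
    · obtain ⟨g, hg, rfl⟩ := List.mem_map.1 hg
      exact ⟨_, rfl⟩
    · obtain ⟨g, hgL, rfl⟩ := List.mem_map.1 hg
      obtain ⟨k, rfl⟩ := List.get_of_mem hgL
      rcases (L.gates.get k).arity_eq with h | h
      · intro i j
        have : Subsingleton (Fin (L.gates.get k).arity) := by rw [h]; infer_instance
        left
        rw [show i = j from Subsingleton.elim (α := Fin (L.gates.get k).arity) i j]
      · intro i j
        have hk := hπ ⟨k, h⟩
        obtain ⟨i, rfl⟩ := (finCongr h.symm).surjective i
        obtain ⟨j, rfl⟩ := (finCongr h.symm).surjective j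
        fin_cases i <;> fin_cases j
        exacts [Or.inl rfl, Or.inr hk, Or.inr hk.symm, Or.inl rfl]
  refine ⟨A ++ ([M] ++ B), fun K hK => ?_, ?_, fun ψ => ?_⟩
  · simp only [List.mem_append, List.mem_singleton] at hK
    rcases hK with hK | rfl | hK
    exacts [hA K hK, hM, hB K hK]
  · simp only [Circuit.depth, List.length_append, List.length_cons, List.length_nil] at *
    omega
  · rw [Circuit.toMatrix_append, Circuit.toMatrix_append, ← Matrix.mulVec_mulVec,
      ← Matrix.mulVec_mulVec, hA'', Circuit.toMatrix_singleton, Circuit.toMatrix_singleton,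
      Layer.map_mulVec_withAncillas, hB'']
    congr 1
    ext1 i
    change dataQubit s (π⁻¹ (π (f i))) = dataQubit s (f i)
    rw [show π⁻¹ (π (f i)) = f i from π.symm_apply_apply _]

/-- For one data qubit at each node, the overhead depth factor of the hypercube is at most
`4 * n + 1`. -/
theorem overheadFactor_hypercube_le (hn : n ≠ 0) (loc : Fin (2 ^ n) ↪ (Fin n → Bool) × Fin Q)
    (hloc : Function.Injective fun i => (loc i).1) :
    overheadFactor (hypercube n) Q (2 ^ n) loc ≤ (4 * n + 1 : ℕ) := by
  let e : Fin (2 ^ n) ≃ (Fin n → Bool) := Equiv.ofBijective _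
    ((Fintype.bijective_iff_injective_and_card _).2 ⟨hloc, by simp⟩)
  -- With `2 ^ n` qubits at distinct nodes, every node holds exactly one, and `loc` determines its
  -- memory slot.
  have h : loc = e.toEmbedding.trans (dataQubit fun v => (loc (e.symm v)).2) := by
    ext1 i
    refine Prod.ext rfl ?_
    change _ = (loc (e.symm (e i))).2
    rw [e.symm_apply_apply]
  refine overheadFactor_le _ _ _ fun L => ?_
  rw [h]
  exact exists_emulates_layer hn _ _ L

end Routing

end DQC

/-! ### The asymptotic bounds -/

theorem corollary1 (Q : ℕ → ℕ) (hQ_pos : ∀ n, 1 ≤ Q n)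
    (hQ : (fun n : ℕ => (Q n : ℝ)) =O[Filter.atTop] fun n : ℕ => Real.log ((2 : ℝ) ^ n)) :
    ((fun n : ℕ => ((DQC.hypercube n).maxDegree : ℝ)) =O[Filter.atTop]
        fun n : ℕ => Real.log ((2 : ℝ) ^ n)) ∧
      ∃ K : ℝ, ∀ n : ℕ, 2 ≤ n →
        ∀ loc : Fin (2 ^ n) ↪ (Fin n → Bool) × Fin (Q n),
          Function.Injective (fun i => (loc i).1) →
            DQC.overheadFactor (DQC.hypercube n) (Q n) (2 ^ n) loc ≤
              ENNReal.ofReal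
                (K * (Real.log ((2 : ℝ) ^ n) ^ 2 * Real.log (Real.log ((2 : ℝ) ^ n)))) := by
  have hlog : 0 < Real.log 2 := Real.log_pos one_lt_two
  constructor
  · refine Asymptotics.IsBigO.of_bound (Real.log 2)⁻¹ (Filter.Eventually.of_forall fun n => ?_)
    have hdeg : ((DQC.hypercube n).maxDegree : ℝ) ≤ n :=
      Nat.cast_le.2 (DQC.hypercube_maxDegree_le n)
    rw [Real.log_pow, Real.norm_of_nonneg (by positivity), Real.norm_of_nonneg (by positivity)]
    field_simp
    exact hdeg
  -- This is `log log N` at `n = 2`, its least value in the range; it is positive because `2 * log 2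
  -- > 1`.
  · have hc : 0 < Real.log (2 * Real.log 2) := by
      apply Real.log_pos
      have := Real.log_two_gt_d9
      linarith
    -- The `5` comes from `4 * n + 1 ≤ 5 * n ^ 2`; the denominator cancels `(log 2) ^ 2` and the
    -- lower bound for `log log N`.
    refine ⟨5 / (Real.log 2 ^ 2 * Real.log (2 * Real.log 2)), fun n hn loc hloc => ?_⟩
    refine (DQC.overheadFactor_hypercube_le (by omega) loc hloc).trans ?_
    rw [← ENNReal.ofReal_natCast]
    apply ENNReal.ofReal_le_ofReal
    have hn' : (2 : ℝ) ≤ n := by exact_mod_cast hn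
    rw [Real.log_pow]
    calc ((4 * n + 1 : ℕ) : ℝ) ≤ 5 * (n : ℝ) ^ 2 := by push_cast; nlinarith
      _ = 5 / (Real.log 2 ^ 2 * Real.log (2 * Real.log 2)) *
          ((n * Real.log 2) ^ 2 * Real.log (2 * Real.log 2)) := by
        rw [div_mul_eq_mul_div, eq_div_iff (by positivity)]
        ring
      _ ≤ _ := by
        gcongr
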